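/- Language. Fix disjoint sets $C$ (justification constants) and $D$ (propositional constants), propositional variables $V_P=\{x_0,x_1,\dots\}$ and justification variables $V_J=\{v_0,v_1,\dots\}$; $V=V_P\cup V_J$. Justification terms $Tm(C)$ are built from $V_J\cup C$ by $s\cdot t$ and $s+t$. Formulas $Fm(C,D)$ are built from $V_P\cup D$ by $\varphi\to\psi$, $\neg\varphi$, $\varphi\equiv\psi$, $\varphi<\psi$, $s\equiv t$, $s\le t$, $\varphi{:}true$, $\varphi{:}false$, $\square\varphi$, $\varphi{:}t$, $\forall x.\varphi$ (only for $x\in V_P$ free in $\varphi$) and $\bigwedge u.\varphi$ (only for $u\in V_J$ free in $\varphi$). $\exists$, $\bigvee$, $\wedge$, $\leftrightarrow$ are the usual abbreviations. Substitutions $\sigma$ map variables and constants to formulas or terms according to sort; $\varphi[\sigma]$ is capture-avoiding substitution, where a bound variable is renamed to the least variable of its sort greater than all variables free in some $\sigma(w)$, $w$ a free variable or constant of the quantified formula. $=_\alpha$ is congruence up to renaming of bound variables. $\varphi\prec\psi$ means: $\psi'[x:=\varphi]=_\alpha\psi$ for some $x\in V_P$ and some $\psi'\ne x$ in which $x$ is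 free. Axioms. $Ax$ is the smallest set that contains a sufficient set of propositional tautologies (a set of tautologies from which all tautologies follow by Modus Ponens), is closed under $\varphi\mapsto\forall x.\varphi$ ($x$ free in $\varphi$) and $\varphi\mapsto\bigwedge u.\varphi$ ($u$ free in $\varphi$), and contains all formulas of the forms: $\varphi{:}true\leftrightarrow\varphi$; $\varphi{:}false\leftrightarrow\neg\varphi$; $(\varphi\to\psi){:}s\to(\varphi{:}t\to\psi{:}(s\cdot t))$; $\varphi{:}s\to\varphi{:}(s+t)$; $\varphi{:}t\to\varphi{:}(s+t)$; $\square\varphi\leftrightarrow\bigvee u.(\varphi{:}u)$ ($u$ not free in $\varphi$); $\square\varphi\to\varphi$; $\varphi<\psi$ whenever $\varphi\prec\psi$; $(\varphi<\psi)\to((\psi<\chi)\to(\varphi<\chi))$; $\varphi\equiv\psi$ whenever $\varphi=_\alpha\psi$; $(\varphi\equiv\psi)\to(\varphi\to\psi)$; $\bigl(\bigwedge_{z}\sigma(z)\equiv\sigma'(z)\bigr)\to(\varphi[\sigma]\equiv\varphi[\sigma'])$, with $z$ ranging over the free variables of $\varphi$, and the same with a term $t$ in place of $\varphi$, for substitutions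 $\sigma,\sigma'$ that are the identity on constants; $\varphi[u:=t]\to\bigvee u.\varphi$; $\bigwedge u.\varphi\to\varphi[u:=t]$; $\bigwedge u.(\psi\to\varphi)\to(\bigwedge u.\psi\to\bigwedge u.\varphi)$; $\bigwedge u.(\psi\to\varphi)\to(\psi\to\bigwedge u.\varphi)$ ($u$ not free in $\psi$); the four analogous schemas for $\forall x$, $\exists x$ and formulas substituted for $x$; $(s\le t)\leftrightarrow\forall x.(x{:}s\to x{:}t)$; $(s\equiv t)\leftrightarrow(s\le t)\wedge(t\le s)$. $Ax+(4)$ is $Ax$ together with all formulas $\square\varphi\to\square\square\varphi$. Models. An $\in_J$-model $\mathcal M$ consists of a set $L$ of indexes with binary operations $+^{\Lambda},\cdot^{\Lambda}$ and a partial order $\le^{\Lambda}$; a set $M$ that is the disjoint union of $TRUE$ and $FALSE$; sets $REASON_l$ ($l\in L$) with $NECESSARY=\bigcup_{l\in L}REASON_l\subseteq TRUE$, such that $l\mapsto REASON_l$ is an order isomorphism of $(L,\le^{\Lambda})$ onto $(\{REASON_l\},\subseteq)$; a transitive relation $<^{\mathcal M}$ on $M$; and a function $\Gamma$ giving $\Gamma(\varphi,\gamma)\in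 M$ and $\Gamma(s,\gamma)\in L$ for formulas $\varphi$, terms $s$ and (sort-respecting) assignments $\gamma:V\to M\cup L$, such that: (EP) $\Gamma(z,\gamma)=\gamma(z)$ for $z\in V$; (CP) $\Gamma(e,\gamma)$ depends only on the values of $\gamma$ on the free variables of $e$; (SP) $\Gamma(e[\sigma],\gamma)=\Gamma(e,\gamma\sigma)$ with $\gamma\sigma(z)=\Gamma(\sigma(z),\gamma)$, for $\sigma$ the identity on constants; (RP) $\varphi\prec\psi$ implies $\Gamma(\varphi,\gamma)<^{\mathcal M}\Gamma(\psi,\gamma)$; (HP) $\Gamma(s+t,\gamma)=\Gamma(s,\gamma)+^{\Lambda}\Gamma(t,\gamma)$ and $\Gamma(s\cdot t,\gamma)=\Gamma(s,\gamma)\cdot^{\Lambda}\Gamma(t,\gamma)$; and, for all $\gamma$, the truth conditions: $\Gamma(\varphi\to\psi,\gamma)\in TRUE$ iff $\Gamma(\varphi,\gamma)\in FALSE$ or $\Gamma(\psi,\gamma)\in TRUE$; $\Gamma(\neg\varphi,\gamma)\in TRUE$ iff $\Gamma(\varphi,\gamma)\notin TRUE$; $\Gamma(\varphi{:}true,\gamma)\in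 TRUE$ iff $\Gamma(\varphi,\gamma)\in TRUE$; $\Gamma(\varphi{:}false,\gamma)\in TRUE$ iff $\Gamma(\varphi,\gamma)\in FALSE$; $\Gamma(\varphi\equiv\psi,\gamma)\in TRUE$ iff $\Gamma(\varphi,\gamma)=\Gamma(\psi,\gamma)$; $\Gamma(\varphi<\psi,\gamma)\in TRUE$ iff $\Gamma(\varphi,\gamma)<^{\mathcal M}\Gamma(\psi,\gamma)$; $\Gamma(s\equiv t,\gamma)\in TRUE$ iff $\Gamma(s,\gamma)=\Gamma(t,\gamma)$; $\Gamma(s\le t,\gamma)\in TRUE$ iff $\Gamma(s,\gamma)\le^{\Lambda}\Gamma(t,\gamma)$; $\Gamma(\square\varphi,\gamma)\in TRUE$ iff $\Gamma(\varphi,\gamma)\in NECESSARY$; $\Gamma(\varphi{:}t,\gamma)\in TRUE$ iff $\Gamma(\varphi,\gamma)\in REASON_{\Gamma(t,\gamma)}$; $\Gamma(\varphi\to\psi,\gamma)\in REASON_{\Gamma(s,\gamma)}$ and $\Gamma(\varphi,\gamma)\in REASON_{\Gamma(t,\gamma)}$ imply $\Gamma(\psi,\gamma)\in REASON_{\Gamma(s\cdot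 t,\gamma)}$; $\Gamma(\varphi,\gamma)\in REASON_{\Gamma(s,\gamma)}\cup REASON_{\Gamma(t,\gamma)}$ implies $\Gamma(\varphi,\gamma)\in REASON_{\Gamma(s+t,\gamma)}$; $\Gamma(\bigwedge u.\varphi,\gamma)\in TRUE$ iff $\Gamma(\varphi,\gamma_u^l)\in TRUE$ for all $l\in L$; $\Gamma(\forall x.\varphi,\gamma)\in TRUE$ iff $\Gamma(\varphi,\gamma_x^m)\in TRUE$ for all $m\in M$. Put $(\mathcal M,\gamma)\vDash\varphi$ iff $\Gamma(\varphi,\gamma)\in TRUE$. $\mathcal M$ satisfies (4) if $\Gamma(\square\varphi,\gamma)\in TRUE$ implies $\Gamma(\square\square\varphi,\gamma)\in TRUE$ for all $\varphi,\gamma$, and (AxNec) if $\Gamma(\square\chi,\gamma)\in TRUE$ for all $\chi\in Ax+(4)$ and all $\gamma$. Let $\mathcal L\subseteq Fm(C,D)$ be the propositional modal formulas, built from $V_P$ by $\neg,\to,\square$. An S4 frame is a set $W$ with a reflexive transitive relation $R$; for $g:W\to\{0,1\}^{V_P}$, $(w,g)\Vdash\varphi$ is the usual Kripke satisfaction relation.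 Theorem. Let $\mathcal M$ be an $\in_J$-model satisfying (AxNec) and (4), and let $\beta:V_P\to M$ be an assignment. Then there are an S4 frame $(W,R)$, a truth value assignment $g:W\to\{0,1\}^{V_P}$ and a world $w\in W$ such that for all $\varphi\in\mathcal L$ (and every extension of $\beta$ to an assignment of justification variables in $L$) $$(\mathcal M,\beta)\vDash\varphi\iff(w,g)\Vdash\varphi .$$ -/

import Mathlib

namespace EpsilonJ

/-! ### Terms, formulas, free variables, properness

Both sorts of variables are indexed by `ℕ`: propositional variable number `n` and justification
variable number `n` are different objects, because they are introduced by different constructors.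
`C` is the set of justification constants and `D` the set of propositional constants. -/

/-- Justification terms over the justification constants `C`. -/
inductive Tm (C : Type*) where
  | var (u : ℕ)
  | const (c : C)
  | app (s t : Tm C)
  | sum (s t : Tm C)

/-- Formulas, including those with vacuous quantifiers. -/
inductive PreFm (C D : Type*) where
  | var (x : ℕ)
  | const (d : D)
  | imp (φ ψ : PreFm C D)
  | neg (φ : PreFm C D)
  | eqF (φ ψ : PreFm C D)
  | ref (φ ψ : PreFm C D)
  | eqJ (s t : Tm C)
  | le (s t : Tm C)
  | tr (φ : PreFm C D)
  | fls (φ : PreFm C D)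
  | box (φ : PreFm C D)
  | mem (φ : PreFm C D) (t : Tm C)
  | allP (x : ℕ) (φ : PreFm C D)
  | allJ (u : ℕ) (φ : PreFm C D)

section Occurrences

variable {C D : Type*}

/-- The (justification) variables of a term. -/
def Tm.vars : Tm C → Finset ℕ
  | .var u => {u}
  | .const _ => ∅
  | .app s t => s.vars ∪ t.vars
  | .sum s t => s.vars ∪ t.vars

open scoped Classical in
/-- The constants of a term. -/
noncomputable def Tm.consts : Tm C → Finset C
  | .var _ => ∅
  | .const c => {c}
  | .app s t => s.consts ∪ t.consts
  | .sum s t => s.consts ∪ t.consts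

/-- Free propositional variables. -/
def PreFm.fvarP : PreFm C D → Finset ℕ
  | .var x => {x}
  | .const _ => ∅
  | .imp φ ψ => φ.fvarP ∪ ψ.fvarP
  | .neg φ => φ.fvarP
  | .eqF φ ψ => φ.fvarP ∪ ψ.fvarP
  | .ref φ ψ => φ.fvarP ∪ ψ.fvarP
  | .eqJ _ _ => ∅
  | .le _ _ => ∅
  | .tr φ => φ.fvarP
  | .fls φ => φ.fvarP
  | .box φ => φ.fvarP
  | .mem φ _ => φ.fvarP
  | .allP x φ => φ.fvarP.erase x
  | .allJ _ φ => φ.fvarP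

/-- Free justification variables. -/
def PreFm.fvarJ : PreFm C D → Finset ℕ
  | .var _ => ∅
  | .const _ => ∅
  | .imp φ ψ => φ.fvarJ ∪ ψ.fvarJ
  | .neg φ => φ.fvarJ
  | .eqF φ ψ => φ.fvarJ ∪ ψ.fvarJ
  | .ref φ ψ => φ.fvarJ ∪ ψ.fvarJ
  | .eqJ s t => s.vars ∪ t.vars
  | .le s t => s.vars ∪ t.vars
  | .tr φ => φ.fvarJ
  | .fls φ => φ.fvarJ
  | .box φ => φ.fvarJ
  | .mem φ t => φ.fvarJ ∪ t.vars
  | .allP _ φ => φ.fvarJ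
  | .allJ u φ => φ.fvarJ.erase u

open scoped Classical in
/-- Propositional constants occurring in a formula. -/
noncomputable def PreFm.conP : PreFm C D → Finset D
  | .var _ => ∅
  | .const d => {d}
  | .imp φ ψ => φ.conP ∪ ψ.conP
  | .neg φ => φ.conP
  | .eqF φ ψ => φ.conP ∪ ψ.conP
  | .ref φ ψ => φ.conP ∪ ψ.conP
  | .eqJ _ _ => ∅
  | .le _ _ => ∅
  | .tr φ => φ.conP
  | .fls φ => φ.conP
  | .box φ => φ.conP
  | .mem φ _ => φ.conP
  | .allP _ φ => φ.conP
  | .allJ _ φ => φ.conP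

open scoped Classical in
/-- Justification constants occurring in a formula. -/
noncomputable def PreFm.conJ : PreFm C D → Finset C
  | .var _ => ∅
  | .const _ => ∅
  | .imp φ ψ => φ.conJ ∪ ψ.conJ
  | .neg φ => φ.conJ
  | .eqF φ ψ => φ.conJ ∪ ψ.conJ
  | .ref φ ψ => φ.conJ ∪ ψ.conJ
  | .eqJ s t => s.consts ∪ t.consts
  | .le s t => s.consts ∪ t.consts
  | .tr φ => φ.conJ
  | .fls φ => φ.conJ
  | .box φ => φ.conJ
  | .mem φ t => φ.conJ ∪ t.consts
  | .allP _ φ => φ.conJ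
  | .allJ _ φ => φ.conJ

/-- A formula is proper if every quantifier in it binds a variable that is free in its scope. -/
def PreFm.Proper : PreFm C D → Prop
  | .var _ => True
  | .const _ => True
  | .imp φ ψ => φ.Proper ∧ ψ.Proper
  | .neg φ => φ.Proper
  | .eqF φ ψ => φ.Proper ∧ ψ.Proper
  | .ref φ ψ => φ.Proper ∧ ψ.Proper
  | .eqJ _ _ => True
  | .le _ _ => True
  | .tr φ => φ.Proper
  | .fls φ => φ.Proper
  | .box φ => φ.Proper
  | .mem φ _ => φ.Proper
  | .allP x φ => x ∈ φ.fvarP ∧ φ.Proper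
  | .allJ u φ => u ∈ φ.fvarJ ∧ φ.Proper

end Occurrences

/-- The set `Fm(C, D)` of (proper) formulas. -/
def Fm (C D : Type*) := {φ : PreFm C D // φ.Proper}

namespace Fm

variable {C D : Type*}

def fvarP (φ : Fm C D) : Finset ℕ := φ.1.fvarP
def fvarJ (φ : Fm C D) : Finset ℕ := φ.1.fvarJ

def var (x : ℕ) : Fm C D := ⟨.var x, trivial⟩
def const (d : D) : Fm C D := ⟨.const d, trivial⟩
def imp (φ ψ : Fm C D) : Fm C D := ⟨.imp φ.1 ψ.1, φ.2, ψ.2⟩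
def neg (φ : Fm C D) : Fm C D := ⟨.neg φ.1, φ.2⟩
/-- Propositional identity `φ ≡ ψ`. -/
def eqF (φ ψ : Fm C D) : Fm C D := ⟨.eqF φ.1 ψ.1, φ.2, ψ.2⟩
/-- Propositional reference `φ < ψ`. -/
def ref (φ ψ : Fm C D) : Fm C D := ⟨.ref φ.1 ψ.1, φ.2, ψ.2⟩
/-- Identity of justifications `s ≡ t`. -/
def eqJ (s t : Tm C) : Fm C D := ⟨.eqJ s t, trivial⟩
/-- Containment of justifications `s ≤ t`. -/
def le (s t : Tm C) : Fm C D := ⟨.le s t, trivial⟩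
/-- `φ : true` -/
def tr (φ : Fm C D) : Fm C D := ⟨.tr φ.1, φ.2⟩
/-- `φ : false` -/
def fls (φ : Fm C D) : Fm C D := ⟨.fls φ.1, φ.2⟩
def box (φ : Fm C D) : Fm C D := ⟨.box φ.1, φ.2⟩
/-- `φ : t` -/
def mem (φ : Fm C D) (t : Tm C) : Fm C D := ⟨.mem φ.1 t, φ.2⟩
/-- `∀ x. φ` -/
def allP (x : ℕ) (φ : Fm C D) (h : x ∈ φ.fvarP) : Fm C D := ⟨.allP x φ.1, h, φ.2⟩
/-- `⋀ u. φ` -/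
def allJ (u : ℕ) (φ : Fm C D) (h : u ∈ φ.fvarJ) : Fm C D := ⟨.allJ u φ.1, h, φ.2⟩

/-- `∃ x. φ`, that is `¬ ∀ x. ¬ φ` -/
def exP (x : ℕ) (φ : Fm C D) (h : x ∈ φ.fvarP) : Fm C D := neg (allP x (neg φ) h)
/-- `⋁ u. φ`, that is `¬ ⋀ u. ¬ φ` -/
def exJ (u : ℕ) (φ : Fm C D) (h : u ∈ φ.fvarJ) : Fm C D := neg (allJ u (neg φ) h)
def and (φ ψ : Fm C D) : Fm C D := neg (imp φ (neg ψ))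
def iff (φ ψ : Fm C D) : Fm C D := and (imp φ ψ) (imp ψ φ)

/-- `(φ₁ ∧ ⋯ ∧ φₙ) → χ`, associated to the left; this is `χ` for the empty list. -/
def conjImp : List (Fm C D) → Fm C D → Fm C D
  | [], χ => χ
  | φ :: l, χ => imp (l.foldl and φ) χ

theorem mem_fvarJ_imp_left {u : ℕ} {φ ψ : Fm C D} (h : u ∈ φ.fvarJ) : u ∈ (imp φ ψ).fvarJ :=
  Finset.mem_union_left _ h

theorem mem_fvarJ_imp_right {u : ℕ} {φ ψ : Fm C D} (h : u ∈ ψ.fvarJ) : u ∈ (imp φ ψ).fvarJ :=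
  Finset.mem_union_right _ h

theorem mem_fvarP_imp_left {x : ℕ} {φ ψ : Fm C D} (h : x ∈ φ.fvarP) : x ∈ (imp φ ψ).fvarP :=
  Finset.mem_union_left _ h

theorem mem_fvarP_imp_right {x : ℕ} {φ ψ : Fm C D} (h : x ∈ ψ.fvarP) : x ∈ (imp φ ψ).fvarP :=
  Finset.mem_union_right _ h

theorem mem_fvarJ_mem_var (u : ℕ) (φ : Fm C D) : u ∈ (mem φ (.var u)).fvarJ :=
  Finset.mem_union_right _ (Finset.mem_singleton_self u)

theorem mem_fvarP_var_mem (x : ℕ) (t : Tm C) : x ∈ (mem (var x : Fm C D) t).fvarP :=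
  Finset.mem_singleton_self x

end Fm

/-! ### Substitutions -/

/-- Substitutions with values in arbitrary formulas, proper or not. -/
structure PreSubst (C D : Type*) where
  varP : ℕ → PreFm C D
  varJ : ℕ → Tm C
  conP : D → PreFm C D
  conJ : C → Tm C

section Substitution

variable {C D : Type*}

/-- `σ[x := φ]` for a propositional variable `x`. -/
def PreSubst.updP (σ : PreSubst C D) (x : ℕ) (φ : PreFm C D) : PreSubst C D :=
  { σ with varP := Function.update σ.varP x φ }

/-- `σ[u := t]` for a justification variable `u`. -/
def PreSubst.updJ (σ : PreSubst C D) (u : ℕ) (t : Tm C) : PreSubst C D :=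
  { σ with varJ := Function.update σ.varJ u t }

/-- The least propositional variable greater than all propositional variables that are free in
some `σ(w)`, where `w` is a free variable or a constant of `φ`. -/
noncomputable def PreSubst.forcedP (σ : PreSubst C D) (φ : PreFm C D) : ℕ :=
  (φ.fvarP.biUnion (fun x => (σ.varP x).fvarP) ∪
    φ.conP.biUnion (fun d => (σ.conP d).fvarP)).sup Nat.succ

/-- The least justification variable greater than all justification variables that are free in
some `σ(w)`, where `w` is a free variable or a constant of `φ`. -/
noncomputable def PreSubst.forcedJ (σ : PreSubst C D) (φ : PreFm C D) : ℕ :=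
  (φ.fvarP.biUnion (fun x => (σ.varP x).fvarJ) ∪
    φ.conP.biUnion (fun d => (σ.conP d).fvarJ) ∪
    φ.fvarJ.biUnion (fun u => (σ.varJ u).vars) ∪
    φ.conJ.biUnion (fun c => (σ.conJ c).vars)).sup Nat.succ

/-- `t[σ]` -/
def Tm.subst (σ : PreSubst C D) : Tm C → Tm C
  | .var u => σ.varJ u
  | .const c => σ.conJ c
  | .app s t => .app (s.subst σ) (t.subst σ)
  | .sum s t => .sum (s.subst σ) (t.subst σ)

/-- `φ[σ]` -/
noncomputable def PreFm.subst : PreFm C D → PreSubst C D → PreFm C D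
  | .var x, σ => σ.varP x
  | .const d, σ => σ.conP d
  | .imp φ ψ, σ => .imp (φ.subst σ) (ψ.subst σ)
  | .neg φ, σ => .neg (φ.subst σ)
  | .eqF φ ψ, σ => .eqF (φ.subst σ) (ψ.subst σ)
  | .ref φ ψ, σ => .ref (φ.subst σ) (ψ.subst σ)
  | .eqJ s t, σ => .eqJ (s.subst σ) (t.subst σ)
  | .le s t, σ => .le (s.subst σ) (t.subst σ)
  | .tr φ, σ => .tr (φ.subst σ)
  | .fls φ, σ => .fls (φ.subst σ)
  | .box φ, σ => .box (φ.subst σ)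
  | .mem φ t, σ => .mem (φ.subst σ) (t.subst σ)
  | .allP x φ, σ =>
      .allP (σ.forcedP (.allP x φ))
        (φ.subst (σ.updP x (.var (σ.forcedP (.allP x φ)))))
  | .allJ u φ, σ =>
      .allJ (σ.forcedJ (.allJ u φ))
        (φ.subst (σ.updJ u (.var (σ.forcedJ (.allJ u φ)))))

theorem Tm.vars_subst_sub (t : Tm C) (σ : PreSubst C D) {u v : ℕ} (hu : u ∈ t.vars)
    (hv : v ∈ (σ.varJ u).vars) : v ∈ (t.subst σ).vars := by
  induction t with
  | var w => simp only [Tm.vars, Finset.mem_singleton] at hu; subst hu; exact hv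
  | const c => simp [Tm.vars] at hu
  | app s t ihs iht =>
    simp only [Tm.vars, Tm.subst, Finset.mem_union] at hu ⊢
    exact hu.imp ihs iht
  | sum s t ihs iht =>
    simp only [Tm.vars, Tm.subst, Finset.mem_union] at hu ⊢
    exact hu.imp ihs iht

theorem PreSubst.lt_forcedP {σ : PreSubst C D} {φ : PreFm C D} {x y : ℕ} (hx : x ∈ φ.fvarP)
    (hy : y ∈ (σ.varP x).fvarP) : y < σ.forcedP φ := by
  refine Nat.lt_of_succ_le (Finset.le_sup (f := Nat.succ) ?_)
  exact Finset.mem_union_left _ (Finset.mem_biUnion.2 ⟨x, hx, hy⟩)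

theorem PreSubst.lt_forcedJ {σ : PreSubst C D} {φ : PreFm C D} {u v : ℕ} (hu : u ∈ φ.fvarJ)
    (hv : v ∈ (σ.varJ u).vars) : v < σ.forcedJ φ := by
  refine Nat.lt_of_succ_le (Finset.le_sup (f := Nat.succ) ?_)
  exact Finset.mem_union_left _ (Finset.mem_union_right _ (Finset.mem_biUnion.2 ⟨u, hu, hv⟩))

theorem PreFm.fvarP_subst_sub (φ : PreFm C D) : ∀ (σ : PreSubst C D) {x y : ℕ},
    x ∈ φ.fvarP → y ∈ (σ.varP x).fvarP → y ∈ (φ.subst σ).fvarP := by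
  induction φ with
  | var z => intro σ x y hx hy; simp only [fvarP, Finset.mem_singleton] at hx; subst hx; exact hy
  | const d => intro σ x y hx; simp [fvarP] at hx
  | imp φ ψ ihφ ihψ | eqF φ ψ ihφ ihψ | ref φ ψ ihφ ihψ =>
    intro σ x y hx hy
    simp only [fvarP, subst, Finset.mem_union] at hx ⊢
    exact hx.imp (ihφ σ · hy) (ihψ σ · hy)
  | neg φ ih | tr φ ih | fls φ ih | box φ ih => exact ih
  | eqJ s t | le s t => intro σ x y hx; simp [fvarP] at hx
  | mem φ t ih => exact ih
  | allP z φ ih =>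
    intro σ x y hx hy
    have hlt := PreSubst.lt_forcedP hx hy
    simp only [fvarP, subst, Finset.mem_erase] at hx ⊢
    refine ⟨hlt.ne, ih _ hx.2 ?_⟩
    simpa [PreSubst.updP, Function.update_of_ne hx.1] using hy
  | allJ u φ ih => intro σ x y hx hy; exact ih _ hx hy

theorem PreFm.fvarJ_subst_sub (φ : PreFm C D) : ∀ (σ : PreSubst C D) {u v : ℕ},
    u ∈ φ.fvarJ → v ∈ (σ.varJ u).vars → v ∈ (φ.subst σ).fvarJ := by
  induction φ with
  | var z => intro σ u v hu; simp [fvarJ] at hu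
  | const d => intro σ u v hu; simp [fvarJ] at hu
  | imp φ ψ ihφ ihψ | eqF φ ψ ihφ ihψ | ref φ ψ ihφ ihψ =>
    intro σ u v hu hv
    simp only [fvarJ, subst, Finset.mem_union] at hu ⊢
    exact hu.imp (ihφ σ · hv) (ihψ σ · hv)
  | neg φ ih | tr φ ih | fls φ ih | box φ ih => exact ih
  | eqJ s t | le s t =>
    intro σ u v hu hv
    simp only [fvarJ, subst, Finset.mem_union] at hu ⊢
    exact hu.imp (s.vars_subst_sub σ · hv) (t.vars_subst_sub σ · hv)
  | mem φ t ih =>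
    intro σ u v hu hv
    simp only [fvarJ, subst, Finset.mem_union] at hu ⊢
    exact hu.imp (ih σ · hv) (t.vars_subst_sub σ · hv)
  | allP x φ ih => intro σ u v hu hv; exact ih _ hu hv
  | allJ w φ ih =>
    intro σ u v hu hv
    have hlt := PreSubst.lt_forcedJ hu hv
    simp only [fvarJ, subst, Finset.mem_erase] at hu ⊢
    refine ⟨hlt.ne, ih _ hu.2 ?_⟩
    simpa [PreSubst.updJ, Function.update_of_ne hu.1] using hv

/-- Substituting proper formulas into a proper formula gives a proper formula. -/
theorem PreFm.Proper.subst {φ : PreFm C D} : φ.Proper → ∀ {σ : PreSubst C D},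
    (∀ x, (σ.varP x).Proper) → (∀ d, (σ.conP d).Proper) → (φ.subst σ).Proper := by
  induction φ with
  | var z => intro _ σ hP _; exact hP z
  | const d => intro _ σ _ hD; exact hD d
  | imp φ ψ ihφ ihψ | eqF φ ψ ihφ ihψ | ref φ ψ ihφ ihψ =>
    intro h σ hP hD; exact ⟨ihφ h.1 hP hD, ihψ h.2 hP hD⟩
  | neg φ ih | tr φ ih | fls φ ih | box φ ih => intro h σ hP hD; exact ih h hP hD
  | eqJ s t | le s t => intro _ _ _ _; exact trivial
  | mem φ t ih => intro h σ hP hD; exact ih h hP hD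
  | allP x φ ih =>
    intro h σ hP hD
    refine ⟨φ.fvarP_subst_sub _ h.1 (by simp [PreSubst.updP, fvarP]), ih h.2 (fun z => ?_) hD⟩
    by_cases hz : z = x
    · subst hz; simp [PreSubst.updP, Proper]
    · simpa [PreSubst.updP, Function.update_of_ne hz] using hP z
  | allJ u φ ih =>
    intro h σ hP hD
    exact ⟨φ.fvarJ_subst_sub _ h.1 (by simp [PreSubst.updJ, Tm.vars]), ih h.2 hP hD⟩

end Substitution

/-- Substitutions: variables and constants are mapped to (proper) formulas or to terms, according
to their sort. -/
structure Subst (C D : Type*) extends PreSubst C D where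
  properP : ∀ x, (varP x).Proper
  properD : ∀ d, (conP d).Proper

section Language

variable {C D : Type*}

/-- The formula `σ(x)`. -/
def Subst.atP (σ : Subst C D) (x : ℕ) : Fm C D := ⟨σ.varP x, σ.properP x⟩

/-- `σ : V → Fm(C, D) ∪ Tm(C)`, that is, `σ` is the identity on constants. -/
def Subst.FixesConstants (σ : Subst C D) : Prop :=
  (∀ d, σ.conP d = .const d) ∧ ∀ c, σ.conJ c = .const c

/-- `φ[σ]` -/
noncomputable def Fm.subst (φ : Fm C D) (σ : Subst C D) : Fm C D :=
  ⟨φ.1.subst σ.toPreSubst, φ.2.subst σ.properP σ.properD⟩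

/-- The identity substitution. -/
def Subst.id : Subst C D where
  varP := .var
  varJ := .var
  conP := .const
  conJ := .const
  properP _ := trivial
  properD _ := trivial

/-- The substitution `[x := φ]` for a propositional variable `x`. -/
def Subst.singleP (x : ℕ) (φ : Fm C D) : Subst C D where
  toPreSubst := (Subst.id : Subst C D).toPreSubst.updP x φ.1
  properP z := by
    by_cases hz : z = x
    · subst hz; simpa [PreSubst.updP] using φ.2
    · simp [PreSubst.updP, Function.update_of_ne hz, Subst.id, PreFm.Proper]
  properD _ := trivial

/-- The substitution `[u := t]` for a justification variable `u`. -/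
def Subst.singleJ (u : ℕ) (t : Tm C) : Subst C D where
  toPreSubst := (Subst.id : Subst C D).toPreSubst.updJ u t
  properP _ := trivial
  properD _ := trivial

/-! ### Alpha-congruence and syntactical reference -/

/-- Alpha-congruence. -/
inductive Alpha : Fm C D → Fm C D → Prop
  | refl (φ : Fm C D) : Alpha φ φ
  | symm {φ ψ : Fm C D} : Alpha φ ψ → Alpha ψ φ
  | trans {φ ψ χ : Fm C D} : Alpha φ ψ → Alpha ψ χ → Alpha φ χ
  | imp {φ₁ φ₂ ψ₁ ψ₂ : Fm C D} : Alpha φ₁ ψ₁ → Alpha φ₂ ψ₂ → Alpha (φ₁.imp φ₂) (ψ₁.imp ψ₂)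
  | eqF {φ₁ φ₂ ψ₁ ψ₂ : Fm C D} : Alpha φ₁ ψ₁ → Alpha φ₂ ψ₂ → Alpha (φ₁.eqF φ₂) (ψ₁.eqF ψ₂)
  | ref {φ₁ φ₂ ψ₁ ψ₂ : Fm C D} : Alpha φ₁ ψ₁ → Alpha φ₂ ψ₂ → Alpha (φ₁.ref φ₂) (ψ₁.ref ψ₂)
  | tr {φ ψ : Fm C D} : Alpha φ ψ → Alpha φ.tr ψ.tr
  | fls {φ ψ : Fm C D} : Alpha φ ψ → Alpha φ.fls ψ.fls
  | mem {φ ψ : Fm C D} (t : Tm C) : Alpha φ ψ → Alpha (φ.mem t) (ψ.mem t)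
  | neg {φ ψ : Fm C D} : Alpha φ ψ → Alpha φ.neg ψ.neg
  | box {φ ψ : Fm C D} : Alpha φ ψ → Alpha φ.box ψ.box
  | allJ {φ ψ : Fm C D} {u v : ℕ} (hu : u ∈ φ.fvarJ) (hv : v ∈ ψ.fvarJ) :
      Alpha φ (ψ.subst (.singleJ v (.var u))) → (v ≠ u → u ∉ ψ.fvarJ) →
      Alpha (φ.allJ u hu) (ψ.allJ v hv)
  | allP {φ ψ : Fm C D} {x y : ℕ} (hx : x ∈ φ.fvarP) (hy : y ∈ ψ.fvarP) :
      Alpha φ (ψ.subst (.singleP y (.var x))) → (y ≠ x → x ∉ ψ.fvarP) →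
      Alpha (φ.allP x hx) (ψ.allP y hy)

/-- Syntactical reference `φ ≺ ψ`. -/
def SynRef (φ ψ : Fm C D) : Prop :=
  ∃ (x : ℕ) (ψ' : Fm C D), ψ' ≠ .var x ∧ x ∈ ψ'.fvarP ∧ Alpha (ψ'.subst (.singleP x φ)) ψ

/-! ### Axioms -/

/-- `χ` is (an instance of) a tautology of classical propositional logic: it is true under every
truth value assignment to formulas that respects `→` and `¬`. -/
def Tautology (χ : Fm C D) : Prop :=
  ∀ v : Fm C D → Prop, (∀ φ ψ, v (φ.imp ψ) ↔ (v φ → v ψ)) → (∀ φ, v φ.neg ↔ ¬ v φ) → v χ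

/-- Derivability from a set of formulas by Modus Ponens alone. -/
inductive MPDerivable (Φ : Set (Fm C D)) : Fm C D → Prop
  | hyp {φ : Fm C D} : φ ∈ Φ → MPDerivable Φ φ
  | mp {φ ψ : Fm C D} : MPDerivable Φ (φ.imp ψ) → MPDerivable Φ φ → MPDerivable Φ ψ

/-- `T` is a sufficient set of tautologies: it consists of tautologies, and all tautologies are
derivable from it by Modus Ponens. -/
def IsSufficient (T : Set (Fm C D)) : Prop :=
  (∀ χ ∈ T, Tautology χ) ∧ ∀ χ, Tautology χ → MPDerivable T χ

/-- The equations `σ(x) ≡ σ'(x)` for the free variables `x` of `φ`, in increasing order,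
propositional variables first. -/
def eqsOn (φ : Fm C D) (σ σ' : Subst C D) : List (Fm C D) :=
  (φ.fvarP.sort (· ≤ ·)).map (fun x => (σ.atP x).eqF (σ'.atP x)) ++
    (φ.fvarJ.sort (· ≤ ·)).map (fun u => .eqJ (σ.varJ u) (σ'.varJ u))

/-- The equations `σ(u) ≡ σ'(u)` for the variables `u` of the term `t`, in increasing order. -/
def eqsOnTm (t : Tm C) (σ σ' : Subst C D) : List (Fm C D) :=
  (t.vars.sort (· ≤ ·)).map (fun u => .eqJ (σ.varJ u) (σ'.varJ u))

/-- The set of axioms, built on the set `T` of propositional tautologies. -/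
inductive Ax (T : Set (Fm C D)) : Fm C D → Prop
  | taut {χ : Fm C D} : χ ∈ T → Ax T χ
  | genJ {φ : Fm C D} {u : ℕ} (h : u ∈ φ.fvarJ) : Ax T φ → Ax T (φ.allJ u h)
  | genP {φ : Fm C D} {x : ℕ} (h : x ∈ φ.fvarP) : Ax T φ → Ax T (φ.allP x h)
  | tarskiTrue (φ : Fm C D) : Ax T (φ.tr.iff φ)
  | tarskiFalse (φ : Fm C D) : Ax T (φ.fls.iff φ.neg)
  | application (φ ψ : Fm C D) (s t : Tm C) :
      Ax T (((φ.imp ψ).mem s).imp ((φ.mem t).imp (ψ.mem (.app s t))))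
  | weakeningLeft (φ : Fm C D) (s t : Tm C) : Ax T ((φ.mem s).imp (φ.mem (.sum s t)))
  | weakeningRight (φ : Fm C D) (s t : Tm C) : Ax T ((φ.mem t).imp (φ.mem (.sum s t)))
  | necessity (φ : Fm C D) (u : ℕ) (h : u ∉ φ.fvarJ) :
      Ax T (φ.box.iff ((φ.mem (.var u)).exJ u (Fm.mem_fvarJ_mem_var u φ)))
  | reflexivity (φ : Fm C D) : Ax T (φ.box.imp φ)
  | reference {φ ψ : Fm C D} : SynRef φ ψ → Ax T (φ.ref ψ)
  | referenceTrans (φ ψ χ : Fm C D) : Ax T ((φ.ref ψ).imp ((ψ.ref χ).imp (φ.ref χ)))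
  | alpha {φ ψ : Fm C D} : Alpha φ ψ → Ax T (φ.eqF ψ)
  | identity (φ ψ : Fm C D) : Ax T ((φ.eqF ψ).imp (φ.imp ψ))
  | substFm (φ : Fm C D) (σ σ' : Subst C D) : σ.FixesConstants → σ'.FixesConstants →
      Ax T (.conjImp (eqsOn φ σ σ') ((φ.subst σ).eqF (φ.subst σ')))
  | exIntroJ (φ : Fm C D) (u : ℕ) (h : u ∈ φ.fvarJ) (t : Tm C) :
      Ax T ((φ.subst (.singleJ u t)).imp (φ.exJ u h))
  | allElimJ (φ : Fm C D) (u : ℕ) (h : u ∈ φ.fvarJ) (t : Tm C) :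
      Ax T ((φ.allJ u h).imp (φ.subst (.singleJ u t)))
  | allDistJ (φ ψ : Fm C D) (u : ℕ) (hψ : u ∈ ψ.fvarJ) (hφ : u ∈ φ.fvarJ) :
      Ax T (((ψ.imp φ).allJ u (Fm.mem_fvarJ_imp_left hψ)).imp ((ψ.allJ u hψ).imp (φ.allJ u hφ)))
  | allConstJ (φ ψ : Fm C D) (u : ℕ) (hψ : u ∉ ψ.fvarJ) (hφ : u ∈ φ.fvarJ) :
      Ax T (((ψ.imp φ).allJ u (Fm.mem_fvarJ_imp_right hφ)).imp (ψ.imp (φ.allJ u hφ)))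
  | exIntroP (φ : Fm C D) (x : ℕ) (h : x ∈ φ.fvarP) (ψ : Fm C D) :
      Ax T ((φ.subst (.singleP x ψ)).imp (φ.exP x h))
  | allElimP (φ : Fm C D) (x : ℕ) (h : x ∈ φ.fvarP) (ψ : Fm C D) :
      Ax T ((φ.allP x h).imp (φ.subst (.singleP x ψ)))
  | allDistP (φ ψ : Fm C D) (x : ℕ) (hψ : x ∈ ψ.fvarP) (hφ : x ∈ φ.fvarP) :
      Ax T (((ψ.imp φ).allP x (Fm.mem_fvarP_imp_left hψ)).imp ((ψ.allP x hψ).imp (φ.allP x hφ)))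
  | allConstP (φ ψ : Fm C D) (x : ℕ) (hψ : x ∉ ψ.fvarP) (hφ : x ∈ φ.fvarP) :
      Ax T (((ψ.imp φ).allP x (Fm.mem_fvarP_imp_right hφ)).imp (ψ.imp (φ.allP x hφ)))
  | leDef (s t : Tm C) (x : ℕ) :
      Ax T ((Fm.le s t).iff ((((Fm.var x).mem s).imp ((Fm.var x).mem t)).allP x
        (Fm.mem_fvarP_imp_left (Fm.mem_fvarP_var_mem x s))))
  | extensionality (s t : Tm C) : Ax T ((Fm.eqJ s t).iff ((Fm.le s t).and (Fm.le t s)))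
  | substTm (t : Tm C) (σ σ' : Subst C D) : σ.FixesConstants → σ'.FixesConstants →
      Ax T (.conjImp (eqsOnTm t σ σ') (.eqJ (t.subst σ.toPreSubst) (t.subst σ'.toPreSubst)))

/-- The axioms together with all formulas `□φ → □□φ`. -/
def AxFour (T : Set (Fm C D)) (χ : Fm C D) : Prop :=
  Ax T χ ∨ ∃ φ : Fm C D, χ = φ.box.imp φ.box.box

end Language

/-! ### Models -/

/-- Assignments, given by their restrictions to the two sorts of variables. -/
structure Assignment (M L : Type*) where
  onP : ℕ → M
  onJ : ℕ → L

namespace Assignment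

variable {M L : Type*}

def updP (γ : Assignment M L) (x : ℕ) (m : M) : Assignment M L :=
  { γ with onP := Function.update γ.onP x m }

def updJ (γ : Assignment M L) (u : ℕ) (l : L) : Assignment M L :=
  { γ with onJ := Function.update γ.onJ u l }

end Assignment

/-- Models for the language `Fm(C, D)` with propositional universe `M` and set `L` of indexes.
The Gamma-function is split into its values `val` on formulas and its values `valT` on terms. -/
structure Model (C D M L : Type*) where
  plus : L → L → L
  times : L → L → L
  order : PartialOrder L
  TRUE : Set M
  FALSE : Set M
  NECESSARY : Set M
  REASON : L → Set M
  /-- the reference relation -/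
  below : M → M → Prop
  val : Fm C D → Assignment M L → M
  valT : Tm C → Assignment M L → L
  true_union_false : TRUE ∪ FALSE = Set.univ
  true_inter_false : TRUE ∩ FALSE = ∅
  necessary_subset : NECESSARY ⊆ TRUE
  necessary_eq : NECESSARY = ⋃ l, REASON l
  /-- `l ↦ REASON l` is an order isomorphism onto its range (it is injective by antisymmetry) -/
  le_iff : ∀ k l, order.le k l ↔ REASON k ⊆ REASON l
  below_trans : ∀ a b c, below a b → below b c → below a c
  ep_prop : ∀ x γ, val (.var x) γ = γ.onP x
  ep_just : ∀ u γ, valT (.var u) γ = γ.onJ u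
  cp_fm : ∀ φ γ γ', (∀ x ∈ φ.fvarP, γ.onP x = γ'.onP x) → (∀ u ∈ φ.fvarJ, γ.onJ u = γ'.onJ u) →
    val φ γ = val φ γ'
  cp_tm : ∀ s γ γ', (∀ u ∈ s.vars, γ.onJ u = γ'.onJ u) → valT s γ = valT s γ'
  sp_fm : ∀ (φ : Fm C D) (σ : Subst C D) γ, σ.FixesConstants →
    val (φ.subst σ) γ = val φ ⟨fun x => val (σ.atP x) γ, fun u => valT (σ.varJ u) γ⟩
  sp_tm : ∀ (s : Tm C) (σ : Subst C D) γ, σ.FixesConstants →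
    valT (s.subst σ.toPreSubst) γ =
      valT s ⟨fun x => val (σ.atP x) γ, fun u => valT (σ.varJ u) γ⟩
  rp : ∀ φ ψ γ, SynRef φ ψ → below (val φ γ) (val ψ γ)
  hp_sum : ∀ s t γ, valT (.sum s t) γ = plus (valT s γ) (valT t γ)
  hp_app : ∀ s t γ, valT (.app s t) γ = times (valT s γ) (valT t γ)
  tc_imp : ∀ φ ψ γ, val (φ.imp ψ) γ ∈ TRUE ↔ (val φ γ ∈ FALSE ∨ val ψ γ ∈ TRUE)
  tc_neg : ∀ φ γ, val φ.neg γ ∈ TRUE ↔ val φ γ ∉ TRUE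
  tc_tr : ∀ φ γ, val φ.tr γ ∈ TRUE ↔ val φ γ ∈ TRUE
  tc_fls : ∀ φ γ, val φ.fls γ ∈ TRUE ↔ val φ γ ∈ FALSE
  tc_eqF : ∀ φ ψ γ, val (φ.eqF ψ) γ ∈ TRUE ↔ val φ γ = val ψ γ
  tc_ref : ∀ φ ψ γ, val (φ.ref ψ) γ ∈ TRUE ↔ below (val φ γ) (val ψ γ)
  tc_eqJ : ∀ s t γ, val (.eqJ s t) γ ∈ TRUE ↔ valT s γ = valT t γ
  tc_le : ∀ s t γ, val (.le s t) γ ∈ TRUE ↔ order.le (valT s γ) (valT t γ)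
  tc_box : ∀ φ γ, val φ.box γ ∈ TRUE ↔ val φ γ ∈ NECESSARY
  tc_mem : ∀ φ t γ, val (φ.mem t) γ ∈ TRUE ↔ val φ γ ∈ REASON (valT t γ)
  tc_app : ∀ φ ψ s t γ, val (φ.imp ψ) γ ∈ REASON (valT s γ) → val φ γ ∈ REASON (valT t γ) →
    val ψ γ ∈ REASON (valT (.app s t) γ)
  tc_sum : ∀ φ s t γ, val φ γ ∈ REASON (valT s γ) ∪ REASON (valT t γ) →
    val φ γ ∈ REASON (valT (.sum s t) γ)
  tc_allJ : ∀ φ u h γ, val (φ.allJ u h) γ ∈ TRUE ↔ ∀ l, val φ (γ.updJ u l) ∈ TRUE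
  tc_allP : ∀ φ x h γ, val (φ.allP x h) γ ∈ TRUE ↔ ∀ m, val φ (γ.updP x m) ∈ TRUE

namespace Model

variable {C D M L : Type*}

/-- `(𝓜, γ) ⊨ φ` -/
def Sat (𝓜 : Model C D M L) (γ : Assignment M L) (φ : Fm C D) : Prop :=
  𝓜.val φ γ ∈ 𝓜.TRUE

/-- Truth condition (4). -/
def Four (𝓜 : Model C D M L) : Prop :=
  ∀ (φ : Fm C D) (γ : Assignment M L), 𝓜.val φ.box γ ∈ 𝓜.TRUE → 𝓜.val φ.box.box γ ∈ 𝓜.TRUE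

/-- Truth condition (AxNec), for the axioms built on the set `T` of tautologies. -/
def AxNec (𝓜 : Model C D M L) (T : Set (Fm C D)) : Prop :=
  ∀ χ : Fm C D, AxFour T χ → ∀ γ : Assignment M L, 𝓜.val χ.box γ ∈ 𝓜.TRUE

end Model

/-! ### Propositional modal logic -/

/-- The language of propositional modal logic over the propositional variables. -/
inductive ModalFm where
  | var (x : ℕ)
  | neg (φ : ModalFm)
  | imp (φ ψ : ModalFm)
  | box (φ : ModalFm)

/-- The inclusion of the modal language into `Fm(C, D)`. -/
def ModalFm.toFm {C D : Type*} : ModalFm → Fm C D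
  | .var x => .var x
  | .neg φ => φ.toFm.neg
  | .imp φ ψ => φ.toFm.imp ψ.toFm
  | .box φ => φ.toFm.box

/-- Frames of modal logic S4 with set of worlds `W`. -/
structure S4Frame (W : Type*) where
  R : W → W → Prop
  refl : ∀ w, R w w
  trans : ∀ w₁ w₂ w₃, R w₁ w₂ → R w₂ w₃ → R w₁ w₃

/-- `(w, g) ⊩ φ` -/
def S4Frame.Forces {W : Type*} (F : S4Frame W) (g : W → ℕ → Bool) : W → ModalFm → Prop
  | w, .var x => g w x = true
  | w, .neg φ => ¬ F.Forces g w φ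
  | w, .imp φ ψ => ¬ F.Forces g w φ ∨ F.Forces g w ψ
  | w, .box φ => ∀ w', F.R w w' → F.Forces g w' φ

end EpsilonJ

/-!
The modal formulas true in `𝓜` under an assignment form a maximally `S4`-consistent set, that is, a
world of the canonical frame of `S4`, and the canonical frame satisfies the truth lemma. What has to
be seen is that every theorem of `S4` is necessary in `𝓜`. The sets `REASON l` together make
necessity closed under modus ponens, so (AxNec) makes everything derivable from the axioms by modus
ponens necessary; generalization is admissible in this calculus. The distribution axiom is
derivable there because `□φ` is `⋁ u. φ : u`: reasons `u` for `φ → ψ` and `v` for `φ` yield the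
reason `u · v` for `ψ`.
-/

namespace EpsilonJ

section Derivations

variable {C D : Type*} {T : Set (Fm C D)} {φ ψ χ : Fm C D} {u x : ℕ}

/-- The theorems of the calculus with all formulas in `Ax` as axioms and modus ponens as its only
rule. Neither generalization nor necessitation is a rule, and `□φ → □□φ` is not an axiom. -/
def Derivable (T : Set (Fm C D)) (χ : Fm C D) : Prop :=
  MPDerivable {φ | Ax T φ} χ

namespace Derivable

theorem of_ax (h : Ax T χ) : Derivable T χ :=
  MPDerivable.hyp h

theorem mp (h : Derivable T (φ.imp ψ)) (hφ : Derivable T φ) : Derivable T ψ :=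
  MPDerivable.mp h hφ

theorem of_tautology (hT : IsSufficient T) (h : Tautology χ) : Derivable T χ := by
  have hχ := hT.2 χ h
  clear h
  induction hχ with
  | hyp h => exact of_ax (.taut h)
  | mp _ _ ih₁ ih₂ => exact ih₁.mp ih₂

theorem imp_trans (hT : IsSufficient T) (h₁ : Derivable T (φ.imp ψ))
    (h₂ : Derivable T (ψ.imp χ)) : Derivable T (φ.imp χ) :=
  ((of_tautology hT fun v hi _ => by simp only [hi]; tauto :
    Derivable T ((φ.imp ψ).imp ((ψ.imp χ).imp (φ.imp χ)))).mp h₁).mp h₂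

theorem imp_swap (hT : IsSufficient T) (h : Derivable T (φ.imp (ψ.imp χ))) :
    Derivable T (ψ.imp (φ.imp χ)) :=
  (of_tautology hT fun v hi _ => by simp only [hi]; tauto).mp h

theorem imp_imp_of_imp (hT : IsSufficient T) (φ : Fm C D) (h : Derivable T (ψ.imp χ)) :
    Derivable T ((φ.imp ψ).imp (φ.imp χ)) :=
  (of_tautology hT fun v hi _ => by simp only [hi]; tauto).mp h

theorem neg_imp_neg (hT : IsSufficient T) (h : Derivable T (φ.imp ψ)) :
    Derivable T (ψ.neg.imp φ.neg) :=
  (of_tautology hT fun v hi hn => by simp only [hi, hn]; tauto).mp h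

theorem neg_imp_comm (hT : IsSufficient T) (h : Derivable T (φ.neg.imp ψ)) :
    Derivable T (ψ.neg.imp φ) :=
  (of_tautology hT fun v hi hn => by simp only [hi, hn]; tauto).mp h

theorem iff_mp (hT : IsSufficient T) (h : Derivable T (φ.iff ψ)) : Derivable T (φ.imp ψ) :=
  (of_tautology hT fun v hi hn => by simp only [Fm.iff, Fm.and, hi, hn]; tauto).mp h

theorem iff_mpr (hT : IsSufficient T) (h : Derivable T (φ.iff ψ)) : Derivable T (ψ.imp φ) :=
  (of_tautology hT fun v hi hn => by simp only [Fm.iff, Fm.and, hi, hn]; tauto).mp h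

theorem allJ (h : Derivable T χ) : ∀ hu : u ∈ χ.fvarJ, Derivable T (χ.allJ u hu) := by
  induction h with
  | hyp h => exact fun hu => of_ax (.genJ hu h)
  | @mp φ ψ _ hφ ihφψ ihφ =>
    intro hψu
    have hφψ := ihφψ (Fm.mem_fvarJ_imp_right hψu)
    by_cases hφu : u ∈ φ.fvarJ
    · exact ((of_ax (.allDistJ ψ φ u hφu hψu)).mp hφψ).mp (ihφ hφu)
    · exact ((of_ax (.allConstJ ψ φ u hφu hψu)).mp hφψ).mp hφ

theorem allP (h : Derivable T χ) : ∀ hx : x ∈ χ.fvarP, Derivable T (χ.allP x hx) := by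
  induction h with
  | hyp h => exact fun hx => of_ax (.genP hx h)
  | @mp φ ψ _ hφ ihφψ ihφ =>
    intro hψx
    have hφψ := ihφψ (Fm.mem_fvarP_imp_right hψx)
    by_cases hφx : x ∈ φ.fvarP
    · exact ((of_ax (.allDistP ψ φ x hφx hψx)).mp hφψ).mp (ihφ hφx)
    · exact ((of_ax (.allConstP ψ φ x hφx hψx)).mp hφψ).mp hφ

theorem exJ_imp (hT : IsSufficient T) (hφ : u ∈ φ.fvarJ) (hψ : u ∉ ψ.fvarJ)
    (h : Derivable T (φ.imp ψ)) : Derivable T ((φ.exJ u hφ).imp ψ) := by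
  have hφ' : u ∈ φ.neg.fvarJ := hφ
  have hall : Derivable T (ψ.neg.imp (φ.neg.allJ u hφ')) :=
    (of_ax (.allConstJ φ.neg ψ.neg u hψ hφ')).mp
      ((neg_imp_neg hT h).allJ (Fm.mem_fvarJ_imp_right hφ'))
  exact neg_imp_comm hT hall

theorem box_imp_of_mem_var_imp (hT : IsSufficient T) (hφ : u ∉ φ.fvarJ) (hψ : u ∉ ψ.fvarJ)
    (h : Derivable T ((φ.mem (.var u)).imp ψ)) : Derivable T (φ.box.imp ψ) :=
  imp_trans hT (iff_mp hT (of_ax (.necessity φ u hφ)))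
    (exJ_imp hT (Fm.mem_fvarJ_mem_var u φ) hψ h)

end Derivable

theorem Tm.subst_eq_self {σ : PreSubst C D} (hJ : σ.varJ = .var) (hC : σ.conJ = .const)
    (t : Tm C) : t.subst σ = t := by
  induction t with
  | var u => exact congrFun hJ u
  | const c => exact congrFun hC c
  | app s t ihs iht | sum s t ihs iht => simp only [subst, ihs, iht]

namespace Derivable

theorem var_mem_imp_box (hT : IsSufficient T) (x : ℕ) (t : Tm C) :
    Derivable T (((Fm.var x).mem t).imp (Fm.var x).box) := by
  let xMem : Tm C → Fm C D := (Fm.var x).mem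
  have hsubst : (xMem (.var 0)).subst (.singleJ 0 t) = xMem t :=
    Subtype.ext <| congrArg (PreFm.mem (.var x)) <|
      Function.update_self (β := fun _ => Tm C) 0 t Tm.var
  have hex : Derivable T ((xMem t).imp ((xMem (.var 0)).exJ 0 (Fm.mem_fvarJ_mem_var 0 _))) :=
    hsubst ▸ of_ax (.exIntroJ (xMem (.var 0)) 0 (Fm.mem_fvarJ_mem_var 0 _) t)
  exact imp_trans hT hex
    (iff_mpr hT (of_ax (.necessity (Fm.var x) 0 (Finset.notMem_empty 0))))

/-- Substituting `t` for `u` in `φ : u` may rename bound variables of `φ`, so the introduction rule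
for `⋁ u` is applied to a variable in place of `φ`, for which `φ` is then substituted. -/
theorem mem_imp_box (hT : IsSufficient T) (φ : Fm C D) (t : Tm C) :
    Derivable T ((φ.mem t).imp φ.box) := by
  let xImp : Fm C D := ((Fm.var 0).mem t).imp (Fm.var 0).box
  have hx : 0 ∈ xImp.fvarP := Fm.mem_fvarP_imp_left (Fm.mem_fvarP_var_mem 0 t)
  have hvar : (Subst.singleP 0 φ).varP 0 = φ.1 :=
    Function.update_self (β := fun _ => PreFm C D) 0 φ.1 PreFm.var
  have ht : t.subst (Subst.singleP 0 φ).toPreSubst = t := t.subst_eq_self rfl rfl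
  have hsubst : xImp.subst (.singleP 0 φ) = (φ.mem t).imp φ.box :=
    Subtype.ext <| congrArg₂ PreFm.imp (congrArg₂ PreFm.mem hvar ht) (congrArg PreFm.box hvar)
  exact hsubst ▸ (of_ax (.allElimP xImp 0 hx φ)).mp ((var_mem_imp_box hT 0 t).allP hx)

theorem box_distrib (hT : IsSufficient T) (φ ψ : Fm C D) :
    Derivable T ((φ.imp ψ).box.imp (φ.box.imp ψ.box)) := by
  obtain ⟨u, hu⟩ := Infinite.exists_notMem_finset (φ.imp ψ).fvarJ
  obtain ⟨v, hv⟩ := Infinite.exists_notMem_finset ((φ.imp ψ).mem (.var u)).fvarJ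
  obtain ⟨hvφψ, -⟩ := not_or.1 (mt Finset.mem_union.2 hv)
  obtain ⟨huφ, huψ⟩ := not_or.1 (mt Finset.mem_union.2 hu)
  obtain ⟨hvφ, hvψ⟩ := not_or.1 (mt Finset.mem_union.2 hvφψ)
  have huv : Derivable T (((φ.imp ψ).mem (.var u)).imp ((φ.mem (.var v)).imp ψ.box)) :=
    imp_trans hT (of_ax (.application φ ψ (.var u) (.var v)))
      (imp_imp_of_imp hT _ (mem_imp_box hT ψ _))
  have hv_elim : Derivable T (φ.box.imp (((φ.imp ψ).mem (.var u)).imp ψ.box)) :=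
    box_imp_of_mem_var_imp hT hvφ (Finset.notMem_union.2 ⟨hv, hvψ⟩) (imp_swap hT huv)
  exact box_imp_of_mem_var_imp hT hu (Finset.notMem_union.2 ⟨huφ, huψ⟩) (imp_swap hT hv_elim)

end Derivable

end Derivations

namespace ModalFm

/-- Truth value assignments to modal formulas that respect the propositional connectives, encoded
as the set of formulas assigned the value true; boxed formulas are treated as atoms. -/
structure IsValuation (v : Set ModalFm) : Prop where
  imp : ∀ φ ψ, φ.imp ψ ∈ v ↔ (φ ∈ v → ψ ∈ v)
  neg : ∀ φ, φ.neg ∈ v ↔ φ ∉ v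

/-- Instances of classical propositional tautologies in the modal language. -/
def IsTautology (χ : ModalFm) : Prop :=
  ∀ v, IsValuation v → χ ∈ v

/-- The theorems of the modal logic `S4`. -/
inductive S4Provable : ModalFm → Prop
  | taut {φ : ModalFm} : IsTautology φ → S4Provable φ
  | distrib (φ ψ : ModalFm) : S4Provable ((φ.imp ψ).box.imp (φ.box.imp ψ.box))
  | reflexivity (φ : ModalFm) : S4Provable (φ.box.imp φ)
  | four (φ : ModalFm) : S4Provable (φ.box.imp φ.box.box)
  | mp {φ ψ : ModalFm} : S4Provable (φ.imp ψ) → S4Provable φ → S4Provable ψ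
  | nec {φ : ModalFm} : S4Provable φ → S4Provable φ.box

/-- Propositional theories: sets of modal formulas closed under propositional consequence. -/
structure IsTheory (S : Set ModalFm) : Prop where
  taut : ∀ χ, IsTautology χ → χ ∈ S
  mp : ∀ φ ψ, φ.imp ψ ∈ S → φ ∈ S → ψ ∈ S

namespace IsTheory

variable {S : Set ModalFm} {φ ψ χ : ModalFm}

theorem mem_of_entails (hS : IsTheory S) (h : ∀ v, IsValuation v → φ ∈ v → ψ ∈ v)
    (hφ : φ ∈ S) : ψ ∈ S :=
  hS.mp φ ψ (hS.taut _ fun v hv => (hv.imp _ _).2 (h v hv)) hφ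

theorem mem_of_entails₂ (hS : IsTheory S) (h : ∀ v, IsValuation v → φ ∈ v → ψ ∈ v → χ ∈ v)
    (hφ : φ ∈ S) (hψ : ψ ∈ S) : χ ∈ S :=
  hS.mp ψ χ (hS.mem_of_entails (fun v hv hφv => (hv.imp _ _).2 (h v hv hφv)) hφ) hψ

theorem adjoin (hS : IsTheory S) (ψ : ModalFm) : IsTheory {χ | ψ.imp χ ∈ S} where
  taut χ hχ := hS.taut _ fun v hv => (hv.imp _ _).2 fun _ => hχ v hv
  mp φ χ := hS.mem_of_entails₂ fun v hv => by simp only [hv.imp]; tauto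

theorem sUnion {c : Set (Set ModalFm)} (hc : ∀ S ∈ c, IsTheory S) (hchain : IsChain (· ⊆ ·) c)
    (hne : c.Nonempty) : IsTheory (⋃₀ c) where
  taut χ hχ := hne.imp fun S hS => ⟨hS, (hc S hS).taut χ hχ⟩
  mp := by
    rintro φ ψ ⟨S₁, hS₁, hφψ⟩ ⟨S₂, hS₂, hφ⟩
    obtain ⟨S, hS, h₁, h₂⟩ := hchain.directedOn S₁ hS₁ S₂ hS₂
    exact ⟨S, hS, (hc S hS).mp φ ψ (h₁ hφψ) (h₂ hφ)⟩

theorem isValuation_of_maximal (hS : Maximal (fun S => IsTheory S ∧ φ ∉ S) S) :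
    IsValuation S := by
  obtain ⟨hth, hφ⟩ := hS.prop
  have himp {ψ : ModalFm} (hψ : ψ ∉ S) : ψ.imp φ ∈ S := by
    by_contra hψφ
    have hsub : S ⊆ {χ | ψ.imp χ ∈ S} := fun χ =>
      hth.mem_of_entails fun v hv hχ => (hv.imp _ _).2 fun _ => hχ
    have hψψ : ψ.imp ψ ∈ S := hth.taut _ fun v hv => (hv.imp _ _).2 id
    exact hψ (hS.le_of_ge ⟨hth.adjoin ψ, hψφ⟩ hsub hψψ)
  have hneg (ψ : ModalFm) : ψ.neg ∈ S ↔ ψ ∉ S := by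
    refine ⟨fun hnψ hψ => hφ ?_, fun hψ => by_contra fun hnψ => hφ ?_⟩
    · exact hth.mem_of_entails₂ (fun v hv h h' => absurd h' ((hv.neg ψ).1 h)) hnψ hψ
    · exact hth.mem_of_entails₂
        (fun v hv => by simp only [hv.imp, hv.neg]; tauto) (himp hψ) (himp hnψ)
  refine ⟨fun ψ χ => ⟨hth.mp ψ χ, fun h => ?_⟩, hneg⟩
  by_cases hψ : ψ ∈ S
  · exact hth.mem_of_entails (fun v hv hχ => (hv.imp _ _).2 fun _ => hχ) (h hψ)
  · exact hth.mem_of_entails (fun v hv hnψ => (hv.imp _ _).2 fun hψv =>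
      absurd hψv ((hv.neg ψ).1 hnψ)) ((hneg ψ).2 hψ)

theorem exists_isValuation (hS : IsTheory S) (hφ : φ ∉ S) :
    ∃ v, IsValuation v ∧ S ⊆ v ∧ φ ∉ v := by
  obtain ⟨v, hSv, hv⟩ := zorn_subset_nonempty {S | IsTheory S ∧ φ ∉ S}
    (fun c hc hchain hne => ⟨⋃₀ c, ⟨sUnion (fun S hS => (hc hS).1) hchain hne,
      fun ⟨S, hS, hφS⟩ => (hc hS).2 hφS⟩, fun _ => Set.subset_sUnion_of_mem⟩) S ⟨hS, hφ⟩
  exact ⟨v, isValuation_of_maximal hv, hSv, hv.prop.2⟩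

end IsTheory

/-- Worlds of the canonical frame: maximally `S4`-consistent sets, given as the valuations that
make all theorems of `S4` true. -/
structure S4World where
  carrier : Set ModalFm
  isValuation : IsValuation carrier
  mem_of_provable : ∀ φ, S4Provable φ → φ ∈ carrier

namespace S4World

variable {w : S4World} {φ ψ : ModalFm}

theorem mem_of_imp_provable (h : S4Provable (φ.imp ψ)) (hφ : φ ∈ w.carrier) : ψ ∈ w.carrier :=
  (w.isValuation.imp φ ψ).1 (w.mem_of_provable _ h) hφ

theorem isTheory_box_mem (w : S4World) : IsTheory {φ | φ.box ∈ w.carrier} where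
  taut _ hχ := w.mem_of_provable _ (.nec (.taut hχ))
  mp φ ψ hφψ := (w.isValuation.imp _ _).1 (mem_of_imp_provable (.distrib φ ψ) hφψ)

end S4World

/-- The canonical frame of `S4`. -/
def canonicalFrame : S4Frame S4World where
  R w w' := ∀ φ : ModalFm, φ.box ∈ w.carrier → φ ∈ w'.carrier
  refl _ φ := S4World.mem_of_imp_provable (.reflexivity φ)
  trans _ _ _ h₁ h₂ φ h := h₂ φ (h₁ φ.box (S4World.mem_of_imp_provable (.four φ) h))

open scoped Classical in
/-- The truth value assignment of the canonical model of `S4`. -/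
noncomputable def canonicalVal (w : S4World) (x : ℕ) : Bool :=
  decide (ModalFm.var x ∈ w.carrier)

theorem box_mem_iff_forall_mem (w : S4World) (φ : ModalFm) :
    φ.box ∈ w.carrier ↔ ∀ w', canonicalFrame.R w w' → φ ∈ w'.carrier := by
  refine ⟨fun h w' hww' => hww' φ h, fun h => by_contra fun hφ => ?_⟩
  obtain ⟨v, hv, hwv, hφv⟩ := w.isTheory_box_mem.exists_isValuation hφ
  let w' : S4World := ⟨v, hv, fun ψ hψ => hwv (w.mem_of_provable _ hψ.nec)⟩
  exact hφv (h w' hwv)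

theorem canonicalFrame_forces_iff (φ : ModalFm) :
    ∀ w, canonicalFrame.Forces canonicalVal w φ ↔ φ ∈ w.carrier := by
  induction φ with
  | var x => simp only [S4Frame.Forces, canonicalVal, decide_eq_true_eq, implies_true]
  | neg φ ih => simp only [S4Frame.Forces, ih, (S4World.isValuation _).neg, implies_true]
  | imp φ ψ ihφ ihψ =>
    simp only [S4Frame.Forces, ihφ, ihψ, (S4World.isValuation _).imp, imp_iff_not_or, implies_true]
  | box φ ih => simp only [S4Frame.Forces, ih, box_mem_iff_forall_mem, implies_true]

section Embedding

variable {C D : Type*}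

theorem fvarJ_toFm (φ : ModalFm) : (φ.toFm : Fm C D).fvarJ = ∅ := by
  induction φ with
  | var x => rfl
  | neg _ ih | box _ ih => exact ih
  | imp _ _ ihφ ihψ => exact Finset.union_eq_empty.2 ⟨ihφ, ihψ⟩

theorem IsTautology.tautology_toFm {φ : ModalFm} (h : IsTautology φ) :
    Tautology (φ.toFm : Fm C D) :=
  fun v hi hn => h {ψ | v ψ.toFm} ⟨fun _ _ => hi _ _, fun _ => hn _⟩

end Embedding

end ModalFm

namespace Assignment

variable {M L : Type*} (γ : Assignment M L) (l : L)

theorem updJ_onJ_self (u : ℕ) : (γ.updJ u l).onJ u = l :=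
  Function.update_self (β := fun _ => L) u l γ.onJ

theorem updJ_onJ_of_ne {u v : ℕ} (h : v ≠ u) : (γ.updJ u l).onJ v = γ.onJ v :=
  Function.update_of_ne (β := fun _ => L) h l γ.onJ

end Assignment

namespace Model

variable {C D M L : Type*} {T : Set (Fm C D)} {𝓜 : Model C D M L} {φ ψ : Fm C D}
  {γ : Assignment M L}

theorem mem_FALSE_iff {m : M} : m ∈ 𝓜.FALSE ↔ m ∉ 𝓜.TRUE := by
  have hcompl : IsCompl 𝓜.TRUE 𝓜.FALSE :=
    ⟨Set.disjoint_iff_inter_eq_empty.2 𝓜.true_inter_false,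
      codisjoint_iff.2 𝓜.true_union_false⟩
  rw [← hcompl.compl_eq, Set.mem_compl_iff]

theorem sat_imp : 𝓜.Sat γ (φ.imp ψ) ↔ (𝓜.Sat γ φ → 𝓜.Sat γ ψ) := by
  simp only [Sat, tc_imp, mem_FALSE_iff, imp_iff_not_or]

theorem sat_box_iff_exists_reason :
    𝓜.Sat γ φ.box ↔ ∃ l, 𝓜.val φ γ ∈ 𝓜.REASON l := by
  rw [Sat, tc_box, necessary_eq, Set.mem_iUnion]

theorem sat_of_sat_box (h : 𝓜.Sat γ φ.box) : 𝓜.Sat γ φ :=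
  𝓜.necessary_subset ((𝓜.tc_box φ γ).1 h)

theorem val_updJ_of_notMem {u : ℕ} (hu : u ∉ φ.fvarJ) (γ : Assignment M L) (l : L) :
    𝓜.val φ (γ.updJ u l) = 𝓜.val φ γ :=
  𝓜.cp_fm _ _ _ (fun _ _ => rfl) fun _ hv =>
    γ.updJ_onJ_of_ne l (ne_of_mem_of_not_mem hv hu)

theorem sat_box_mp (hφψ : 𝓜.Sat γ (φ.imp ψ).box) (hφ : 𝓜.Sat γ φ.box) : 𝓜.Sat γ ψ.box := by
  obtain ⟨u, hu⟩ := Infinite.exists_notMem_finset (φ.imp ψ).fvarJ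
  obtain ⟨v, hv⟩ := Infinite.exists_notMem_finset ((φ.imp ψ).mem (.var u)).fvarJ
  obtain ⟨hvφψ, hvu⟩ := not_or.1 (mt Finset.mem_union.2 hv)
  rw [sat_box_iff_exists_reason] at hφψ hφ ⊢
  obtain ⟨k, hk⟩ := hφψ
  obtain ⟨l, hl⟩ := hφ
  let γ' := (γ.updJ u k).updJ v l
  have hval {χ : Fm C D} (hχ : χ.fvarJ ⊆ (φ.imp ψ).fvarJ) : 𝓜.val χ γ' = 𝓜.val χ γ := by
    rw [val_updJ_of_notMem (fun h => hvφψ (hχ h)), val_updJ_of_notMem fun h => hu (hχ h)]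
  have hγ'u : 𝓜.valT (.var u) γ' = k := by
    have huv : u ≠ v := fun h => hvu (Finset.mem_singleton.2 h.symm)
    rw [ep_just, Assignment.updJ_onJ_of_ne _ _ huv, Assignment.updJ_onJ_self]
  have hγ'v : 𝓜.valT (.var v) γ' = l := by
    rw [ep_just, Assignment.updJ_onJ_self]
  have happ := 𝓜.tc_app φ ψ (.var u) (.var v) γ'
    (by rwa [hval subset_rfl, hγ'u]) (by rwa [hval Finset.subset_union_left, hγ'v])
  exact ⟨_, hval Finset.subset_union_right ▸ happ⟩

namespace AxNec

theorem sat_box_of_derivable (hAxNec : 𝓜.AxNec T) (h : Derivable T φ) (γ : Assignment M L) :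
    𝓜.Sat γ φ.box := by
  induction h with
  | hyp h => exact hAxNec _ (.inl h) γ
  | mp _ _ ihφψ ihφ => exact sat_box_mp ihφψ ihφ

theorem sat_box_four (hAxNec : 𝓜.AxNec T) (φ : Fm C D) (γ : Assignment M L) :
    𝓜.Sat γ (φ.box.imp φ.box.box).box :=
  hAxNec _ (.inr ⟨φ, rfl⟩) γ

theorem sat_box_of_provable (hAxNec : 𝓜.AxNec T) (hT : IsSufficient T) {φ : ModalFm}
    (h : φ.S4Provable) (γ : Assignment M L) : 𝓜.Sat γ φ.toFm.box := by
  induction h with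
  | taut hφ => exact hAxNec.sat_box_of_derivable (.of_tautology hT hφ.tautology_toFm) γ
  | distrib φ ψ => exact hAxNec.sat_box_of_derivable (.box_distrib hT φ.toFm ψ.toFm) γ
  | reflexivity φ => exact hAxNec.sat_box_of_derivable (.of_ax (.reflexivity φ.toFm)) γ
  | four φ => exact hAxNec.sat_box_four φ.toFm γ
  | mp _ _ ihφψ ihφ => exact sat_box_mp ihφψ ihφ
  | @nec φ _ ih => exact sat_imp.1 (sat_of_sat_box (hAxNec.sat_box_four φ.toFm γ)) ih

end AxNec

/-- The world of the canonical frame of `S4` that consists of the modal formulas true in `𝓜` under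
`γ`. -/
def world (hAxNec : 𝓜.AxNec T) (hT : IsSufficient T) (γ : Assignment M L) :
    ModalFm.S4World where
  carrier := {φ | 𝓜.Sat γ φ.toFm}
  isValuation := ⟨fun _ _ => sat_imp, fun φ => 𝓜.tc_neg φ.toFm γ⟩
  mem_of_provable _ h := sat_of_sat_box (hAxNec.sat_box_of_provable hT h γ)

theorem sat_toFm_congr (φ : ModalFm) (β : ℕ → M) (δ δ' : ℕ → L) :
    𝓜.Sat ⟨β, δ⟩ φ.toFm ↔ 𝓜.Sat ⟨β, δ'⟩ φ.toFm := by
  rw [Sat, Sat, 𝓜.cp_fm φ.toFm ⟨β, δ⟩ ⟨β, δ'⟩ (fun _ _ => rfl)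
    (by simp only [φ.fvarJ_toFm, Finset.notMem_empty, false_imp_iff, implies_true])]

end Model

end EpsilonJ

theorem theorem820 {C D M L : Type*} (T : Set (EpsilonJ.Fm C D)) (hT : EpsilonJ.IsSufficient T)
    (𝓜 : EpsilonJ.Model C D M L) (hAxNec : 𝓜.AxNec T) (hFour : 𝓜.Four) (β : ℕ → M) :
    ∃ (W : Type) (F : EpsilonJ.S4Frame W) (g : W → ℕ → Bool) (w : W),
      ∀ (δ : ℕ → L) (φ : EpsilonJ.ModalFm), 𝓜.Sat ⟨β, δ⟩ φ.toFm ↔ F.Forces g w φ := by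
  obtain hδ | ⟨⟨δ₀⟩⟩ := isEmpty_or_nonempty (ℕ → L)
  · let F : EpsilonJ.S4Frame Unit :=
      ⟨fun _ _ => True, fun _ => trivial, fun _ _ _ _ _ => trivial⟩
    exact ⟨Unit, F, fun _ _ => true, (), fun δ => hδ.elim δ⟩
  · refine ⟨_, EpsilonJ.ModalFm.canonicalFrame, EpsilonJ.ModalFm.canonicalVal,
      EpsilonJ.Model.world hAxNec hT ⟨β, δ₀⟩, fun δ φ => ?_⟩
    rw [EpsilonJ.ModalFm.canonicalFrame_forces_iff]
    exact EpsilonJ.Model.sat_toFm_congr φ β δ δ₀
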